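/- Let $m\ge 1$ and let $\alpha_1,\dots,\alpha_{2m-1}$ be real numbers with $\alpha_j+\alpha_{2m-j}=0$ for $1\le j\le m-1$. Let $\mathfrak r$ be a real solvable Lie algebra of dimension $2m+2$ whose nilradical $\mathfrak n$ (greatest nilpotent ideal) has a basis $X_1,\dots,X_{2m+1}$ with $$[X_{2+j},X_{2m+1-j}]=X_1\ (0\le j\le m-1),\qquad [X_{2+j},X_{2m+1}]=\alpha_jX_{1+j}\ (1\le j\le 2m-2),$$ all brackets $[X_i,X_k]$, $i<k$, not listed being zero. Complete it by $X_{2m+2}$ to a basis of $\mathfrak r$, let $[X_i,X_j]=\sum_k C_{ij}^kX_k$, and let $x_1,\dots,x_{2m+2}$ be the corresponding coordinates $x_k(\xi)=\xi(X_k)$ on $\mathfrak r^*$. For a nonempty open $U\subseteq\mathfrak r^*$, an *invariant on $U$* is a function $F$ that is $C^\infty$ on $U$ and satisfies $F(\xi\circ e^{\operatorname{ad}y})=F(\xi)$ whenever $y\in\mathfrak r$ and $\xi\circ e^{t\operatorname{ad}y}\in U$ for all $t\in[0,1]$; for $U=\mathfrak r^*$ these are the smooth functions that are constant on the coadjoint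 orbits. Functions are *functionally independent* on $U$ if their differentials are linearly independent at all points of a dense subset of $U$. A *fundamental set of invariants* on $U$ is a maximal set of functionally independent invariants on $U$. Then: 0. $\det\Bigl(\sum_k C_{ij}^kx_k\Bigr)_{i,j}=x_1^{2m}\Bigl(\sum_k C_{1,2m+2}^kx_k\Bigr)^2$ for all $x\in\mathbb R^{2m+2}$. 1. If $[X_{2m+2},X_1]\ne0$, then $\mathfrak r$ has no nontrivial invariants: for every nonempty open $U$ fundamental sets of invariants on $U$ exist and each has $0$ elements, and every invariant on a connected open $U$ (in particular on $\mathfrak r^*$) is constant there. 2. If $[X_{2m+2},X_1]=0$, then $\mathfrak r$ has exactly two functionally independent invariants, one of which can be taken to be $x_1$: there is a function $F_2$ on $\mathfrak r^*$ such that for every nonempty open $U$ (in particular $U=\mathfrak r^*$) the set $\{x_1,F_2\}$ is a fundamental set of invariants on $U$, and every fundamental set of invariants on $U$ has exactly two elements. -/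

import Mathlib

open scoped ContDiff

noncomputable section

/-- The nilradical of a Lie algebra: its greatest nilpotent ideal, where an ideal is nilpotent if
it is nilpotent as a Lie algebra in its own right. (Mathlib's `LieAlgebra.maxNilpotentIdeal` is
a different ideal: it asks for nilpotency as a module over the whole algebra.) -/
def IsNilradical {L : Type*} [LieRing L] [LieAlgebra ℝ L] (N : LieIdeal ℝ L) : Prop :=
  IsGreatest {J : LieIdeal ℝ L | LieRing.IsNilpotent J} N

/-- `X` is a basis `X₁, …, X_{2m+1}` of the Lie algebra `n` in which the bracket is
* `[X_{2+j}, X_{2m+1-j}] = X₁` for `0 ≤ j ≤ m - 1`,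
* `[X_{2+j}, X_{2m+1}] = α_j X_{1+j}` for `1 ≤ j ≤ 2m - 2`,
* all brackets `[X_i, X_k]`, `i < k`, that are not listed vanish,

where `α_j + α_{2m-j} = 0` for `1 ≤ j ≤ m - 1`.
The basis vector `X_i` is `X` at the index `i - 1` of `Fin (2 * m + 1)`. -/
structure IsNAlphaBasis {n : Type*} [LieRing n] [LieAlgebra ℝ n] (m : ℕ) (α : ℕ → ℝ)
    (X : Module.Basis (Fin (2 * m + 1)) ℝ n) : Prop where
  skew : ∀ j : ℕ, 1 ≤ j → j < m → α j + α (2 * m - j) = 0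
  pair : ∀ (j : ℕ) (hj : j < m),
    ⁅X ⟨1 + j, by omega⟩, X ⟨2 * m - j, by omega⟩⁆ = X 0
  chain : ∀ (j : ℕ) (_ : 1 ≤ j) (hj : j ≤ 2 * m - 2),
    ⁅X ⟨1 + j, by omega⟩, X (Fin.last (2 * m))⁆ = α j • X ⟨j, by omega⟩
  unlisted : ∀ i k : Fin (2 * m + 1), i < k →
    ¬ (1 ≤ i.val ∧ i.val + k.val = 2 * m + 1) → ¬ (2 ≤ i.val ∧ k.val = 2 * m) →
    ⁅X i, X k⁆ = 0

section Invariants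

variable {ι L : Type*} [Fintype ι] [DecidableEq ι] [LieRing L] [LieAlgebra ℝ L]

/-- The structure constants: `[b i, b j] = ∑ k, structConst b i j k • b k`. -/
def structConst (b : Module.Basis ι ℝ L) (i j k : ι) : ℝ := b.repr ⁅b i, b j⁆ k

/-- The commutator matrix `(∑ k, C_{ij}^k x_k)_{i,j}` at the point of the dual space with
coordinates `x`. -/
def commutatorMatrix (b : Module.Basis ι ℝ L) (x : ι → ℝ) : Matrix ι ι ℝ :=
  Matrix.of fun i j => ∑ k, structConst b i j k * x k

/-- The dual space of `L` is identified with `ι → ℝ` through the coordinates `x_k = ξ (b k)`.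
`coadjointFlow b y t` is the map `ξ ↦ ξ ∘ exp (t • ad y)` in these coordinates, i.e. the coadjoint
action of the group element `exp (-t y)`. -/
def coadjointFlow (b : Module.Basis ι ℝ L) (y : L) (t : ℝ) (x : ι → ℝ) : ι → ℝ :=
  Matrix.vecMul x (NormedSpace.exp (t • LinearMap.toMatrix b b (LieAlgebra.ad ℝ L y)))

/-- `F` is an invariant of the coadjoint representation on the open set `U`: it is smooth on `U`
and constant along every arc `ξ ∘ exp (t • ad y)`, `0 ≤ t ≤ 1`, of a coadjoint orbit that stays
in `U`. For `U = Set.univ` this says that `F` is smooth and fixed by all `exp (ad y)`, hence by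
the group they generate, which is the adjoint group of a connected Lie group with
Lie algebra `L`. -/
def IsInvariantOn (b : Module.Basis ι ℝ L) (U : Set (ι → ℝ)) (F : (ι → ℝ) → ℝ) : Prop :=
  ContDiffOn ℝ ∞ F U ∧
    ∀ (y : L) (x : ι → ℝ), (∀ t ∈ Set.Icc (0 : ℝ) 1, coadjointFlow b y t x ∈ U) →
      F (coadjointFlow b y 1 x) = F x

/-- The functions in `S` are functionally independent on the open set `U`: their differentials
are linearly independent at the points of a dense subset of `U`. -/
def FunctionallyIndependentOn (U : Set (ι → ℝ)) (S : Set ((ι → ℝ) → ℝ)) : Prop :=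
  U ⊆ closure {x ∈ U | LinearIndependent ℝ (fun F : S => fderiv ℝ (F : (ι → ℝ) → ℝ) x)}

/-- A fundamental set of invariants on `U`: a maximal set of functionally independent
invariants. -/
def IsFundamentalSet (b : Module.Basis ι ℝ L) (U : Set (ι → ℝ)) (S : Set ((ι → ℝ) → ℝ)) : Prop :=
  Maximal (fun T : Set ((ι → ℝ) → ℝ) =>
    (∀ F ∈ T, IsInvariantOn b U F) ∧ FunctionallyIndependentOn U T) S

/-- The number of functionally independent invariants on `U` is `n`: fundamental sets of
invariants exist, and each has exactly `n` elements. -/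
def HasInvariantNumber (b : Module.Basis ι ℝ L) (U : Set (ι → ℝ)) (n : ℕ) : Prop :=
  (∃ S, IsFundamentalSet b U S) ∧ ∀ S, IsFundamentalSet b U S → S.encard = n

end Invariants

end

/-!
A smooth function on the dual space is invariant exactly when its differential annihilates the
vectors `ξ ∘ ad y`, that is, the rows of the commutator matrix `M(x)`; this follows by
differentiating along the flows `ξ ∘ exp (t ad y)` and integrating back
(`IsInvariantOn.fderiv_coadjointVec`, `isInvariantOn_of_fderiv`).

The brackets of the basis are such that `M(x)` vanishes above the antidiagonal, with entries
`± x₁` on it except for the two corners `± ∑ₖ C_{1,2m+2}^k xₖ`. Reversing the columns gives a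
triangular matrix and hence the determinant (`det_commutatorMatrix`). If `[X_{2m+2}, X₁] ≠ 0`, the
determinant is nonzero on a dense open set, so the differential of an invariant vanishes there
and, by continuity, everywhere.

If `[X_{2m+2}, X₁] = 0`, then `x₁` is invariant. The middle `2m × 2m` block of `M(x)` is still
invertible for `x₁ ≠ 0`, so the differentials of invariants lie in a space of dimension at most
two there (`eq_zero_of_apply_zero_ne_zero`). A second invariant is found on the slice `x₁ = 1`.
The brackets of `X₂, …, X_{2m+1}` define on it a polynomial Poisson structure whose matrix `P` is
invertible over the polynomials, and `ad X_{2m+2}` is a derivation of it. Differentiating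
`P θ = D`, where `D` holds the components of this derivation up to sign, and using the Jacobi identity
shows that the polynomial 1-form `θ` is closed (`mul_curl_mul_transpose_eq_zero`), hence exact by
the Poincaré lemma for polynomials: `θ = dh`. Then `x_{2m+2} - x₁ h(x₂ / x₁, …, x_{2m+1} / x₁)` is
invariant where `x₁ ≠ 0`; multiplied by a power of the invariant `x₁` it becomes a polynomial
(`casimir`), invariant everywhere by continuity.

It remains to see that every maximal set of independent invariants has two elements
(`isFundamentalSet_pair`). A single invariant `F` with differential nonzero on a dense set extends
to a pair `F, f + t g` for all but countably many real `t`, since the open sets on which this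
fails are disjoint for different `t` (`exists_independent_combination`).
-/

open scoped ContDiff

noncomputable section

/-! ### The polynomial Poincaré lemma -/

section Poincare

open MvPolynomial

variable {κ : Type*}

/-- The operator `p ↦ ∫₀¹ tᶜ⁻¹ p(t x) dt`, for `c ≥ 1`, which divides a monomial of
degree `d` by `d + c`. -/
def radialIntegral (κ : Type*) (c : ℕ) : MvPolynomial κ ℝ →ₗ[ℝ] MvPolynomial κ ℝ :=
  (basisMonomials κ ℝ).constr ℝ fun s => monomial s (1 / ((s.degree : ℝ) + c))

theorem radialIntegral_monomial (c : ℕ) (s : κ →₀ ℕ) (a : ℝ) :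
    radialIntegral κ c (monomial s a) = monomial s (a / (s.degree + c)) := by
  have h : monomial s a = a • (basisMonomials κ ℝ s) := by
    simp [coe_basisMonomials, smul_monomial]
  rw [h, map_smul, radialIntegral, Module.Basis.constr_basis, smul_monomial]
  congr 1
  simp [div_eq_mul_inv]

theorem pderiv_radialIntegral (c : ℕ) (j : κ) (p : MvPolynomial κ ℝ) :
    pderiv j (radialIntegral κ c p) = radialIntegral κ (c + 1) (pderiv j p) := by
  induction p using MvPolynomial.induction_on' with
  | add p q hp hq => simp [hp, hq]
  | monomial s a =>
    rw [radialIntegral_monomial, pderiv_monomial, pderiv_monomial, radialIntegral_monomial]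
    rcases Nat.eq_zero_or_pos (s j) with h | h
    · simp [h]
    · have hs : s = (s - Finsupp.single j 1) + Finsupp.single j 1 :=
        (tsub_add_cancel_of_le
          (by simpa [Nat.one_le_iff_ne_zero, Nat.pos_iff_ne_zero] using h)).symm
      have hd : s.degree = (s - Finsupp.single j 1).degree + 1 := by
        conv_lhs => rw [hs]
        simp [map_add, Finsupp.degree_single]
      congr 1
      rw [hd]
      push_cast
      ring

theorem sum_X_mul_pderiv_monomial [Fintype κ] (s : κ →₀ ℕ) (a : ℝ) :
    ∑ i, X i * pderiv i (monomial s a) = monomial s (s.degree * a) := by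
  have : ∀ i, X i * pderiv i (monomial s a) = monomial s (s i * a) := by
    intro i
    rw [X_mul_pderiv_monomial, smul_monomial, nsmul_eq_mul]
  simp_rw [this]
  rw [← map_sum, ← Finset.sum_mul, Finsupp.degree_eq_sum]
  push_cast
  rfl

/-- Polynomial Poincaré lemma: a closed polynomial 1-form is exact. -/
theorem exists_pderiv_eq_of_closed [Fintype κ] [DecidableEq κ] (θ : κ → MvPolynomial κ ℝ)
    (h : ∀ i j, pderiv i (θ j) = pderiv j (θ i)) :
    ∃ g : MvPolynomial κ ℝ, ∀ j, pderiv j g = θ j := by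
  have euler : ∀ p : MvPolynomial κ ℝ,
      radialIntegral κ 1 p + ∑ i, X i * pderiv i (radialIntegral κ 1 p) = p := by
    intro p
    induction p using MvPolynomial.induction_on' with
    | add p q hp hq =>
      conv_rhs => rw [← hp, ← hq]
      simp only [map_add, mul_add, Finset.sum_add_distrib]
      ring
    | monomial s a =>
      rw [radialIntegral_monomial, sum_X_mul_pderiv_monomial, ← map_add]
      congr 1
      have : (s.degree : ℝ) + (1 : ℕ) ≠ 0 := by positivity
      field_simp
      push_cast
      ring
  refine ⟨∑ i, X i * radialIntegral κ 1 (θ i), fun j => ?_⟩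
  conv_rhs => rw [← euler (θ j)]
  simp only [map_sum, pderiv_mul, pderiv_X, Finset.sum_add_distrib, Pi.single_apply]
  congr 1
  · simp
  · refine Finset.sum_congr rfl fun i _ => ?_
    rw [pderiv_radialIntegral, pderiv_radialIntegral, h j i]

end Poincare

/-! ### Derivations of a polynomial Poisson bracket -/

section Hamiltonian

open MvPolynomial

variable {κ : Type*} [Fintype κ]

/-- If the 1-form `θ` is taken by a Poisson bivector `P` to a derivation `D` of the Poisson bracket,
then the differential of `θ` is annihilated by `P` on both sides. -/
theorem mul_curl_mul_transpose_eq_zero {R : Type*} [CommRing R] [Algebra ℝ R]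
    (δ : κ → Derivation ℝ R R) (P : Matrix κ κ R) (D θ : κ → R)
    (skew : ∀ i j, P i j = - P j i)
    (jacobi : ∀ i j a, ∑ l, P a l * δ l (P i j) + ∑ l, P j l * δ l (P a i)
      + ∑ l, P i l * δ l (P j a) = 0)
    (leibniz : ∀ i j, ∑ l, D l * δ l (P i j)
      = ∑ l, δ l (D i) * P l j + ∑ l, P i l * δ l (D j))
    (hPθ : ∀ i, ∑ j, P i j * θ j = D i) :
    P * Matrix.of (fun a b => δ a (θ b) - δ b (θ a)) * P.transpose = 0 := by
  ext1 i j
  have hD : ∀ i l, δ l (D i) =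
      ∑ a, δ l (P i a) * θ a + ∑ a, P i a * δ l (θ a) := by
    intro i l
    rw [← hPθ i, map_sum, ← Finset.sum_add_distrib]
    exact Finset.sum_congr rfl fun a _ => by rw [Derivation.leibniz]; simp only [smul_eq_mul]; ring
  have h1 := leibniz i j
  have e0 : ∑ l, D l * δ l (P i j) = -∑ a, θ a * ∑ l, P a l * δ l (P i j) := by
    simp_rw [← hPθ, Finset.sum_mul, Finset.mul_sum, ← Finset.sum_neg_distrib]
    rw [Finset.sum_comm]
    refine Finset.sum_congr rfl fun a _ => Finset.sum_congr rfl fun l _ => ?_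
    rw [skew l a]
    ring
  have e1 : ∑ l, δ l (D i) * P l j = ∑ a, θ a * ∑ l, P j l * δ l (P a i)
      - ∑ a, ∑ l, P i l * P j a * δ a (θ l) := by
    simp_rw [hD, add_mul, Finset.sum_add_distrib, Finset.sum_mul, Finset.mul_sum, sub_eq_add_neg,
      ← Finset.sum_neg_distrib]
    congr 1
    · rw [Finset.sum_comm]
      refine Finset.sum_congr rfl fun a _ => Finset.sum_congr rfl fun l _ => ?_
      rw [skew l j, skew i a, map_neg]
      ring
    · refine Finset.sum_congr rfl fun a _ => Finset.sum_congr rfl fun l _ => ?_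
      rw [skew a j]
      ring
  have e2 : ∑ l, P i l * δ l (D j) = ∑ a, θ a * ∑ l, P i l * δ l (P j a)
      + ∑ a, ∑ l, P i l * P j a * δ l (θ a) := by
    simp_rw [hD, mul_add, Finset.sum_add_distrib, Finset.mul_sum]
    congr 1 <;>
    · rw [Finset.sum_comm]
      refine Finset.sum_congr rfl fun a _ => Finset.sum_congr rfl fun l _ => ?_
      ring
  have e3 : ∑ a, θ a * ∑ l, P a l * δ l (P i j)
      + ∑ a, θ a * ∑ l, P j l * δ l (P a i)
      + ∑ a, θ a * ∑ l, P i l * δ l (P j a) = 0 := by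
    rw [← Finset.sum_add_distrib, ← Finset.sum_add_distrib]
    refine Finset.sum_eq_zero fun a _ => ?_
    rw [← mul_add, ← mul_add, jacobi, mul_zero]
  have e4 : (P * Matrix.of (fun a b => δ a (θ b) - δ b (θ a)) * P.transpose) i j =
      ∑ a, ∑ l, P i l * P j a * δ l (θ a)
      - ∑ a, ∑ l, P i l * P j a * δ a (θ l) := by
    simp only [Matrix.mul_apply, Matrix.transpose_apply, Matrix.of_apply, Finset.sum_mul,
      ← Finset.sum_sub_distrib]
    refine Finset.sum_congr rfl fun a _ => Finset.sum_congr rfl fun l _ => ?_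
    ring
  rw [e4, Matrix.zero_apply]
  rw [e0, e1, e2] at h1
  have cancel : ∀ s₁ s₂ s₃ t₁ t₂ : R,
      -s₁ = s₂ - t₂ + (s₃ + t₁) → s₁ + s₂ + s₃ = 0 → t₁ - t₂ = 0 := by
    intro s₁ s₂ s₃ t₁ t₂ h h'
    linear_combination -h - h'
  exact cancel _ _ _ _ _ h1 e3

/-- A derivation of a symplectic polynomial Poisson structure on affine space is Hamiltonian. -/
theorem exists_hamiltonian [DecidableEq κ] (P : Matrix κ κ (MvPolynomial κ ℝ))
    (D : κ → MvPolynomial κ ℝ)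
    (skew : ∀ i j, P i j = - P j i)
    (jacobi : ∀ i j a, ∑ l, P a l * pderiv l (P i j) + ∑ l, P j l * pderiv l (P a i)
      + ∑ l, P i l * pderiv l (P j a) = 0)
    (leibniz : ∀ i j, ∑ l, D l * pderiv l (P i j)
      = ∑ l, pderiv l (D i) * P l j + ∑ l, P i l * pderiv l (D j))
    (hP : IsUnit P.det) :
    ∃ h : MvPolynomial κ ℝ, ∀ i, ∑ j, P i j * pderiv j h = D i := by
  -- The inverse of `P` has polynomial entries, so the 1-form `θ` is polynomial.
  set θ : κ → MvPolynomial κ ℝ := P⁻¹.mulVec D with hθ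
  have hPθ : ∀ i, ∑ j, P i j * θ j = D i := by
    intro i
    have : P.mulVec θ = D := by
      rw [hθ, Matrix.mulVec_mulVec, Matrix.mul_nonsing_inv _ hP, Matrix.one_mulVec]
    exact congrFun this i
  set W : Matrix κ κ (MvPolynomial κ ℝ) := Matrix.of fun a b => pderiv a (θ b) - pderiv b (θ a)
    with hW
  have key : P * W * P.transpose = 0 :=
    mul_curl_mul_transpose_eq_zero (fun l => pderiv l) P D θ skew jacobi leibniz hPθ
  have hz : W = 0 := by
    have hPt : IsUnit P.transpose.det := by rwa [Matrix.det_transpose]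
    have := congrArg (fun M => P⁻¹ * M * (P.transpose)⁻¹) key
    simpa [Matrix.mul_assoc, Matrix.mul_nonsing_inv _ hPt,
      Matrix.nonsing_inv_mul_cancel_left _ _ hP] using this
  obtain ⟨g, hg⟩ := exists_pderiv_eq_of_closed θ fun i j => by
    have := congrFun (congrFun hz i) j
    simpa [hW, sub_eq_zero] using this
  exact ⟨g, fun i => by simp_rw [hg, hPθ]⟩

end Hamiltonian

/-! ### Determinants of matrices that vanish above the antidiagonal -/

theorem sign_revPerm (n : ℕ) :
    Equiv.Perm.sign (Fin.revPerm : Equiv.Perm (Fin n)) = (-1) ^ (n * (n - 1) / 2) := by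
  rw [Equiv.Perm.sign_eq_prod_prod_Iio]
  have : ∀ j : Fin n, ∏ i ∈ Finset.Iio j,
      (if Fin.revPerm i < Fin.revPerm j then (1 : ℤˣ) else -1) = (-1) ^ (j : ℕ) := by
    intro j
    rw [Finset.prod_congr rfl (g := fun _ => (-1 : ℤˣ)), Finset.prod_const, Fin.card_Iio]
    intro i hi
    rw [if_neg]
    simpa using (Finset.mem_Iio.1 hi).le
  simp_rw [this]
  rw [Finset.prod_pow_eq_pow_sum, Fin.sum_univ_eq_sum_range (fun i => i), Finset.sum_range_id]

/-- The determinant of a matrix with zeros above the antidiagonal. -/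
theorem det_of_antitriangular {R : Type*} [CommRing R] {n : ℕ} (A : Matrix (Fin n) (Fin n) R)
    (h : ∀ i j, j < i.rev → A i j = 0) :
    A.det = (Equiv.Perm.sign (Fin.revPerm : Equiv.Perm (Fin n)) : ℤ) * ∏ i, A i i.rev := by
  have h1 : (A.submatrix id Fin.revPerm).det = ∏ i, A i i.rev := by
    rw [Matrix.det_of_isLowerTriangular]
    · rfl
    · intro i j hij
      apply h
      simpa using hij
  rw [← h1, Matrix.det_permute', ← mul_assoc, ← Int.cast_mul, ← Units.val_mul, Int.units_mul_self]
  simp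

theorem isUnit_det_of_antitriangular {R : Type*} [CommRing R] {n : ℕ}
    (A : Matrix (Fin n) (Fin n) R) (h : ∀ i j, j < i.rev → A i j = 0)
    (hd : ∀ i, IsUnit (A i i.rev)) : IsUnit A.det := by
  rw [det_of_antitriangular A h]
  refine IsUnit.mul ?_ (IsUnit.prod_univ_iff.2 hd)
  exact (Units.isUnit _).map (Int.castRingHom R)

/-! ### Invariants and the coadjoint vector fields -/

theorem commutatorMatrix_skew {ι L : Type*} [Fintype ι] [LieRing L] [LieAlgebra ℝ L]
    (b : Module.Basis ι ℝ L) (x : ι → ℝ) (i j : ι) :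
    commutatorMatrix b x i j = - commutatorMatrix b x j i := by
  simp only [commutatorMatrix, Matrix.of_apply, structConst, ← Finset.sum_neg_distrib]
  refine Finset.sum_congr rfl fun k _ => ?_
  rw [← lie_skew (b i) (b j), map_neg, Finsupp.neg_apply, neg_mul]

section Coadjoint

open Topology

variable {ι L : Type*} [Fintype ι] [DecidableEq ι] [LieRing L] [LieAlgebra ℝ L]

/-- The fundamental vector field of the coadjoint representation: `ξ ↦ ξ ∘ ad y` in
coordinates. -/
def coadjointVec (b : Module.Basis ι ℝ L) (y : L) (x : ι → ℝ) : ι → ℝ :=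
  Matrix.vecMul x (LinearMap.toMatrix b b (LieAlgebra.ad ℝ L y))

variable (b : Module.Basis ι ℝ L)

theorem coadjointVec_apply (y : L) (x : ι → ℝ) (j : ι) :
    coadjointVec b y x j = ∑ k, b.repr ⁅y, b j⁆ k * x k := by
  simp [coadjointVec, Matrix.vecMul, dotProduct, LinearMap.toMatrix_apply, mul_comm]

theorem coadjointVec_basis (i : ι) (x : ι → ℝ) :
    coadjointVec b (b i) x = commutatorMatrix b x i := by
  ext j
  simp [coadjointVec_apply, commutatorMatrix, structConst]

theorem coadjointVec_eq_sum (y : L) (x : ι → ℝ) :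
    coadjointVec b y x = ∑ i, b.repr y i • commutatorMatrix b x i := by
  conv_lhs => rw [← b.sum_repr y]
  simp_rw [← coadjointVec_basis]
  simp only [coadjointVec, map_sum, map_smul, Matrix.vecMul_sum, Matrix.vecMul_smul]

theorem coadjointFlow_zero (y : L) (x : ι → ℝ) : coadjointFlow b y 0 x = x := by
  simp [coadjointFlow]

theorem coadjointFlow_smul (y : L) (s t : ℝ) (x : ι → ℝ) :
    coadjointFlow b (s • y) t x = coadjointFlow b y (t * s) x := by
  simp [coadjointFlow, mul_smul]

open scoped Matrix.Norms.Operator in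
theorem hasDerivAt_coadjointFlow (y : L) (x : ι → ℝ) (t : ℝ) :
    HasDerivAt (fun t => coadjointFlow b y t x) (coadjointVec b y (coadjointFlow b y t x)) t := by
  have h := hasDerivAt_exp_smul_const (𝕂 := ℝ)
    (LinearMap.toMatrix b b (LieAlgebra.ad ℝ L y)) t
  let V : Matrix ι ι ℝ →L[ℝ] (ι → ℝ) := LinearMap.toContinuousLinearMap
    { toFun := fun A => Matrix.vecMul x A
      map_add' := fun A B => Matrix.vecMul_add A B x
      map_smul' := fun c A => Matrix.vecMul_smul x c A }
  have h2 := V.hasFDerivAt.comp_hasDerivAt t h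
  convert! h2 using 1
  rw [coadjointVec, coadjointFlow, Matrix.vecMul_vecMul]
  rfl

variable {b} {U : Set (ι → ℝ)} {F G : (ι → ℝ) → ℝ}

theorem IsInvariantOn.differentiableAt (hU : IsOpen U) (hF : IsInvariantOn b U F) {x : ι → ℝ}
    (hx : x ∈ U) : DifferentiableAt ℝ F x :=
  (hF.1.contDiffAt (hU.mem_nhds hx)).differentiableAt (by simp)

/-- The differential of an invariant vanishes on the tangent spaces of the coadjoint orbits. -/
theorem IsInvariantOn.fderiv_coadjointVec (hU : IsOpen U) (hF : IsInvariantOn b U F)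
    {x : ι → ℝ} (hx : x ∈ U) (y : L) : fderiv ℝ F x (coadjointVec b y x) = 0 := by
  have hflow := hasDerivAt_coadjointFlow b y x 0
  rw [coadjointFlow_zero] at hflow
  have hd : HasDerivAt (fun t => F (coadjointFlow b y t x))
      (fderiv ℝ F x (coadjointVec b y x)) 0 := by
    refine HasFDerivAt.comp_hasDerivAt_of_eq 0 (hF.differentiableAt hU hx).hasFDerivAt hflow ?_
    rw [coadjointFlow_zero]
  have hmem : ∀ᶠ t in 𝓝 (0 : ℝ), coadjointFlow b y t x ∈ U := by
    apply hflow.continuousAt.eventually_mem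
    rw [coadjointFlow_zero]
    exact hU.mem_nhds hx
  obtain ⟨ε, hε, hball⟩ := Metric.eventually_nhds_iff.1 hmem
  have hconst : (fun t => F (coadjointFlow b y t x)) =ᶠ[𝓝 0] fun _ => F x := by
    refine Metric.eventually_nhds_iff.2 ⟨ε, hε, fun s hs => ?_⟩
    -- The arc from `0` to `s` in the direction `y` is the unit arc in the direction `s • y`.
    have := hF.2 (s • y) x fun t ht => by
      rw [coadjointFlow_smul]
      apply hball
      rw [Real.dist_eq, sub_zero] at hs ⊢
      rw [abs_mul, abs_of_nonneg ht.1]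
      exact (mul_le_of_le_one_left (abs_nonneg s) ht.2).trans_lt hs
    simpa [coadjointFlow_smul] using this
  exact hd.unique ((hasDerivAt_const 0 (F x)).congr_of_eventuallyEq hconst)

/-- A smooth function whose differential vanishes along the coadjoint orbits is invariant. -/
theorem isInvariantOn_of_fderiv (hF : ContDiff ℝ ∞ F)
    (h : ∀ x i, fderiv ℝ F x (commutatorMatrix b x i) = 0) (U : Set (ι → ℝ)) :
    IsInvariantOn b U F := by
  refine ⟨hF.contDiffOn, fun y x _ => ?_⟩
  have hd : ∀ t, HasDerivAt (fun t => F (coadjointFlow b y t x)) 0 t := by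
    intro t
    have := ((hF.differentiable (by simp)) _).hasFDerivAt.comp_hasDerivAt t
      (hasDerivAt_coadjointFlow b y x t)
    rwa [coadjointVec_eq_sum, map_sum, Finset.sum_eq_zero fun i _ => by simp [h]] at this
  have := is_const_of_deriv_eq_zero (fun t => (hd t).differentiableAt) (fun t => (hd t).deriv) 1 0
  simpa [coadjointFlow_zero] using this

theorem IsInvariantOn.add_smul (hF : IsInvariantOn b U F) (hG : IsInvariantOn b U G) (t : ℝ) :
    IsInvariantOn b U (F + t • G) := by
  refine ⟨hF.1.add (hG.1.const_smul t), fun y x h => ?_⟩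
  simp [hF.2 y x h, hG.2 y x h]

end Coadjoint

/-! ### Counting functionally independent functions -/

section Independence

variable {ι : Type*} {U : Set (ι → ℝ)}

theorem FunctionallyIndependentOn.exists_mem {S : Set ((ι → ℝ) → ℝ)}
    (hS : FunctionallyIndependentOn U S) {W : Set (ι → ℝ)} (hW : IsOpen W) (hWU : W ⊆ U)
    (hne : W.Nonempty) :
    ∃ x ∈ W, LinearIndepOn ℝ (fun F : (ι → ℝ) → ℝ => fderiv ℝ F x) S := by
  obtain ⟨w, hw⟩ := hne
  obtain ⟨x, hx, hx'⟩ := mem_closure_iff.1 (hS (hWU hw)) W hW hw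
  exact ⟨x, hx, hx'.2⟩

theorem functionallyIndependentOn_pair {f g : (ι → ℝ) → ℝ} (hne : f ≠ g)
    (h : U ⊆ closure {x ∈ U | ∀ c d : ℝ, c • fderiv ℝ f x + d • fderiv ℝ g x = 0 →
      c = 0 ∧ d = 0}) : FunctionallyIndependentOn U {f, g} := by
  refine h.trans (closure_mono fun x hx => ⟨hx.1, ?_⟩)
  exact (LinearIndepOn.pair_iff (fun F : (ι → ℝ) → ℝ => fderiv ℝ F x) hne).2 hx.2

theorem functionallyIndependentOn_singleton {f : (ι → ℝ) → ℝ}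
    (h : U ⊆ closure {x ∈ U | fderiv ℝ f x ≠ 0}) : FunctionallyIndependentOn U {f} := by
  refine h.trans (closure_mono fun x hx => ⟨hx.1, ?_⟩)
  exact LinearIndepOn.singleton (v := fun F : (ι → ℝ) → ℝ => fderiv ℝ F x) hx.2

/-- Let the differentials of `f` and `g` be independent, and that of `F` nonzero, at the points
of dense sets. Then the differentials of `F` and of some `f + t g` are independent at the points
of a dense set: the open sets where this fails for given values of `t` are pairwise disjoint,
so all but countably many of them are empty. -/
theorem exists_independent_combination [Fintype ι] {f g F : (ι → ℝ) → ℝ} (hU : IsOpen U)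
    (hF : ContDiffOn ℝ ∞ F U) (hF0 : U ⊆ closure {x ∈ U | fderiv ℝ F x ≠ 0})
    (hf : ∀ x ∈ U, DifferentiableAt ℝ f x) (hg : ∀ x ∈ U, DifferentiableAt ℝ g x)
    (h : U ⊆ closure {x ∈ U | ∀ c d : ℝ, c • fderiv ℝ f x + d • fderiv ℝ g x = 0 →
      c = 0 ∧ d = 0}) :
    ∃ t : ℝ, U ⊆ closure {x ∈ U | ∀ c d : ℝ,
      c • fderiv ℝ F x + d • fderiv ℝ (f + t • g) x = 0 → c = 0 ∧ d = 0} := by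
  let A : ℝ → Set (ι → ℝ) := fun t => {x ∈ U | ¬ ∀ c d : ℝ,
      c • fderiv ℝ F x + d • fderiv ℝ (f + t • g) x = 0 → c = 0 ∧ d = 0}
  -- `A t` is the set of points where the combination with parameter `t` fails.
  have hdep : ∀ t, ∀ z ∈ A t, fderiv ℝ F z ≠ 0 →
      ∃ a : ℝ, fderiv ℝ f z + t • fderiv ℝ g z = a • fderiv ℝ F z := by
    rintro t z ⟨hzU, hz⟩ hFz
    push Not at hz
    obtain ⟨c, d, hcd, hne⟩ := hz
    have hfd : fderiv ℝ (f + t • g) z = fderiv ℝ f z + t • fderiv ℝ g z := by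
      rw [fderiv_add (hf z hzU) ((hg z hzU).const_smul t), fderiv_const_smul (hg z hzU)]
    rw [hfd] at hcd
    have hd : d ≠ 0 := by
      rintro rfl
      have : c = 0 := by simpa [hFz] using hcd
      exact hne this rfl
    refine ⟨-(d⁻¹ * c), ?_⟩
    have := congrArg (fun v => d⁻¹ • v) hcd
    simp only [smul_add, smul_zero, smul_smul, inv_mul_cancel₀ hd, one_smul,
      inv_mul_cancel_left₀ hd] at this
    rw [eq_neg_of_add_eq_zero_right this]
    module
  have hcount : {t | (interior (A t)).Nonempty}.Countable := by
    refine Set.PairwiseDisjoint.countable_of_isOpen (s := fun t => interior (A t)) ?_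
      (fun _ _ => isOpen_interior) fun t ht => ht
    intro s _ t _ hst
    rw [Function.onFun, Set.disjoint_left]
    intro p hps hpt
    have hopen : IsOpen (U ∩ (fderiv ℝ F) ⁻¹' {0}ᶜ) :=
      (hF.continuousOn_fderiv_of_isOpen hU (by simp)).isOpen_inter_preimage hU
        isOpen_compl_singleton
    have hO : IsOpen (interior (A s) ∩ interior (A t)) := isOpen_interior.inter isOpen_interior
    obtain ⟨q, hq, hqU, hqF⟩ := mem_closure_iff.1 (hF0 (interior_subset hps).1) _ hO ⟨hps, hpt⟩
    obtain ⟨z, ⟨⟨hzs, hzt⟩, -, hzF⟩, -, hz⟩ :=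
      mem_closure_iff.1 (h hqU) _ (hO.inter hopen) ⟨hq, hqU, hqF⟩
    -- At `z` both `f' + s g'` and `f' + t g'` are multiples of `F'`, which forces `s = t`.
    obtain ⟨a, ha⟩ := hdep s z (interior_subset hzs) hzF
    obtain ⟨a', ha'⟩ := hdep t z (interior_subset hzt) hzF
    have h1 : (a' - a) • fderiv ℝ f z + (a' * s - a * t) • fderiv ℝ g z = 0 := by
      have : a' • (fderiv ℝ f z + s • fderiv ℝ g z) -
          a • (fderiv ℝ f z + t • fderiv ℝ g z) = 0 := by
        rw [ha, ha', smul_smul, smul_smul, mul_comm, sub_self]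
      rw [← this]
      module
    obtain ⟨e1, e2⟩ := hz _ _ h1
    have haa : a' = a := sub_eq_zero.1 e1
    have ha0 : a = 0 := by
      rw [haa, ← mul_sub] at e2
      exact (mul_eq_zero.1 e2).resolve_right (sub_ne_zero.2 hst)
    rw [ha0, zero_smul] at ha
    exact one_ne_zero (hz 1 s (by rw [one_smul, ha])).1
  obtain ⟨t, ht⟩ : ∃ t, t ∉ {t | (interior (A t)).Nonempty} := by
    by_contra! hall
    exact Set.not_countable_univ (α := ℝ) (hcount.mono fun t _ => hall t)
  refine ⟨t, fun x hx => mem_closure_iff.2 fun V hV hxV => ?_⟩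
  by_contra hemp
  refine ht ⟨x, mem_interior.2 ⟨V ∩ U, fun z hz => ⟨hz.2, fun hz' => ?_⟩, hV.inter hU, hxV, hx⟩⟩
  exact hemp ⟨z, hz.1, hz.2, hz'⟩

end Independence

section Counting

variable {ι L : Type*} [Fintype ι] [DecidableEq ι] [LieRing L] [LieAlgebra ℝ L]
  {b : Module.Basis ι ℝ L} {U : Set (ι → ℝ)}

/-- If at the points of a nonempty open set the covectors that vanish on the orbit directions
are determined by their values on `n` vectors, then there are at most `n` functionally
independent invariants. -/
theorem encard_le_of_annihilator {n : ℕ} {T : Set ((ι → ℝ) → ℝ)} (hU : IsOpen U)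
    (hT : ∀ F ∈ T, IsInvariantOn b U F) (hind : FunctionallyIndependentOn U T)
    {W : Set (ι → ℝ)} (hWo : IsOpen W) (hWU : W ⊆ U) (hne : W.Nonempty)
    (hW : ∀ x ∈ W, ∃ w : Fin n → ι → ℝ, ∀ φ : (ι → ℝ) →L[ℝ] ℝ,
      (∀ i, φ (commutatorMatrix b x i) = 0) → (∀ i, φ (w i) = 0) → φ = 0) :
    T.encard ≤ n := by
  obtain ⟨x, hxW, hx⟩ := hind.exists_mem hWo hWU hne
  obtain ⟨w, hw⟩ := hW x hxW
  let E : ((ι → ℝ) →L[ℝ] ℝ) →ₗ[ℝ] (Fin n → ℝ) :=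
    { toFun := fun φ i => φ (w i)
      map_add' := fun _ _ => rfl
      map_smul' := fun _ _ => rfl }
  have hann : ∀ φ ∈ Submodule.span ℝ (Set.range fun F : T => fderiv ℝ (F : (ι → ℝ) → ℝ) x),
      ∀ i, φ (commutatorMatrix b x i) = 0 := by
    intro φ hφ i
    induction hφ using Submodule.span_induction with
    | mem φ h =>
      obtain ⟨F, rfl⟩ := h
      simpa [coadjointVec_basis] using (hT F F.2).fderiv_coadjointVec hU (hWU hxW) (b i)
    | zero => simp
    | add φ ψ _ _ h1 h2 => simp [h1, h2]
    | smul c φ _ h => simp [h]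
  have hli : LinearIndepOn ℝ (fun F : (ι → ℝ) → ℝ => E (fderiv ℝ F x)) T := by
    refine LinearIndependent.map (v := fun F : T => fderiv ℝ (F : (ι → ℝ) → ℝ) x) hx ?_
    rw [Submodule.disjoint_def]
    intro φ hφ hφE
    exact hw φ (hann φ hφ) fun i => congrFun (LinearMap.mem_ker.1 hφE) i
  simpa using hli.encard_le_toENat_rank

/-- If no more than two invariants are functionally independent and `f`, `g` are two independent
ones, then `{f, g}` is a fundamental set and every fundamental set has two elements. -/
theorem isFundamentalSet_pair {f g : (ι → ℝ) → ℝ} (hU : IsOpen U) (hne : U.Nonempty)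
    (hf : IsInvariantOn b U f) (hg : IsInvariantOn b U g)
    (h : U ⊆ closure {x ∈ U | ∀ c d : ℝ, c • fderiv ℝ f x + d • fderiv ℝ g x = 0 →
      c = 0 ∧ d = 0})
    (hle : ∀ T : Set ((ι → ℝ) → ℝ), (∀ F ∈ T, IsInvariantOn b U F) →
      FunctionallyIndependentOn U T → T.encard ≤ 2) :
    IsFundamentalSet b U {f, g} ∧ HasInvariantNumber b U 2 := by
  have hne' : ∀ {f g : (ι → ℝ) → ℝ}, U ⊆ closure {x ∈ U | ∀ c d : ℝ,
      c • fderiv ℝ f x + d • fderiv ℝ g x = 0 → c = 0 ∧ d = 0} → f ≠ g := by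
    rintro f g h rfl
    obtain ⟨x, hx⟩ := closure_nonempty_iff.1 (hne.mono h)
    have := hx.2 1 (-1) (by module)
    simp at this
  have hfund : IsFundamentalSet b U {f, g} := by
    refine ⟨⟨?_, functionallyIndependentOn_pair (hne' h) h⟩, fun T hT hsub => ?_⟩
    · rintro F (rfl | rfl)
      exacts [hf, hg]
    · have hT2 := hle T hT.1 hT.2
      exact ((Set.toFinite {f, g}).eq_of_subset_of_encard_le hsub
        (by rwa [Set.encard_pair (hne' h)])).ge
  refine ⟨hfund, ⟨_, hfund⟩, fun S hS => le_antisymm (hle S hS.prop.1 hS.prop.2) ?_⟩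
  by_contra! hlt
  have h1 : S.encard ≤ 1 := Order.le_of_lt_add_one (by simpa [one_add_one_eq_two] using hlt)
  rcases Set.encard_le_one_iff_eq.1 h1 with rfl | ⟨F, rfl⟩
  -- A smaller set is not maximal: the empty set is contained in `{f}`, and a singleton `{F}`
  -- in `{F, f + t g}` for suitable `t`.
  · have hsing : FunctionallyIndependentOn U {f} := by
      refine functionallyIndependentOn_singleton (h.trans (closure_mono fun x hx => ⟨hx.1, ?_⟩))
      intro h0
      exact one_ne_zero (hx.2 1 0 (by simp [h0])).1
    exact hS.le_of_ge ⟨by simpa using hf, hsing⟩ (Set.empty_subset _) (Set.mem_singleton f)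
  · have hF : IsInvariantOn b U F := hS.prop.1 F rfl
    have hF0 : U ⊆ closure {x ∈ U | fderiv ℝ F x ≠ 0} :=
      hS.prop.2.trans (closure_mono fun x hx => ⟨hx.1, hx.2.ne_zero ⟨F, rfl⟩⟩)
    obtain ⟨t, ht⟩ := exists_independent_combination hU hF.1 hF0
      (fun x hx => hf.differentiableAt hU hx) (fun x hx => hg.differentiableAt hU hx) h
    have hmem := hS.le_of_ge (y := {F, f + t • g})
      ⟨by
        rintro G (rfl | rfl)
        exacts [hF, hf.add_smul hg t],
        functionallyIndependentOn_pair (hne' ht) ht⟩ (by simp)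
    exact hne' ht (hmem (Set.mem_insert_of_mem _ rfl)).symm

end Counting

/-! ### Brackets and the commutator determinant -/

section Structure

variable {r : Type*} [LieRing r] [LieAlgebra ℝ r] {m : ℕ} {α : ℕ → ℝ} {N : LieIdeal ℝ r}
  {X : Module.Basis (Fin (2 * m + 1)) ℝ N} {b : Module.Basis (Fin (2 * m + 2)) ℝ r}

/-- The index in `Fin (2 * m + 2)` of the basis vector `X_{i+2}`; together with `0` and
`Fin.last (2 * m + 1)` these exhaust the indices. -/
abbrev mid {m : ℕ} (i : Fin (2 * m)) : Fin (2 * m + 2) := i.succ.castSucc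

theorem rev_mid (i : Fin (2 * m)) : (mid i).rev = mid i.rev := by
  ext
  simp [Fin.val_rev]
  omega

theorem sum_eq_zero_add_mid_add_last {M : Type*} [AddCommMonoid M] (f : Fin (2 * m + 2) → M) :
    ∑ k, f k = f 0 + ∑ i, f (mid i) + f (Fin.last (2 * m + 1)) := by
  rw [Fin.sum_univ_castSucc, Fin.sum_univ_succ, Fin.castSucc_zero]

theorem IsNAlphaBasis.lie_eq_zero (hX : IsNAlphaBasis m α X) {i j : Fin (2 * m + 1)}
    (h : i.val + j.val < 2 * m + 1) : ⁅X i, X j⁆ = 0 := by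
  rcases lt_trichotomy i j with hij | rfl | hij
  · exact hX.unlisted i j hij (by omega) (by omega)
  · exact lie_self _
  · rw [← lie_skew, hX.unlisted j i hij (by omega) (by omega), neg_zero]

theorem IsNAlphaBasis.lie_antidiagonal (hX : IsNAlphaBasis m α X) (i : Fin (2 * m)) :
    ⁅X i.succ, X i.rev.succ⁆ = (if i.val < m then (1 : ℝ) else -1) • X 0 := by
  have hp : ∀ k : Fin (2 * m), k.val < m → ⁅X k.succ, X k.rev.succ⁆ = X 0 := by
    intro k hk
    rw [← hX.pair k hk]
    congr 2 <;> ext <;> simp [Fin.val_rev] <;> omega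
  split_ifs with h
  · rw [hp i h, one_smul]
  · have := hp i.rev (by rw [Fin.val_rev]; omega)
    rw [Fin.rev_rev] at this
    rw [← lie_skew, this, neg_one_smul]

variable (hX : IsNAlphaBasis m α X) (hb : ∀ i : Fin (2 * m + 1), b i.castSucc = (X i : r))

include hb in
theorem repr_last_of_mem {v : r} (hv : v ∈ N) : b.repr v (Fin.last (2 * m + 1)) = 0 := by
  have h : v = ((∑ i, X.repr ⟨v, hv⟩ i • X i : N) : r) := by rw [X.sum_repr]
  rw [h]
  simp only [AddSubmonoidClass.coe_finsetSum, SetLike.val_smul, ← hb, map_sum, map_smul,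
    Module.Basis.repr_self, Finsupp.finsetSum_apply]
  refine Finset.sum_eq_zero fun i _ => ?_
  simp [(Fin.castSucc_lt_last i).ne]

include hb in
theorem lie_mem_of_basis (i j : Fin (2 * m + 2)) : ⁅b i, b j⁆ ∈ N := by
  have h : ∀ (k : Fin (2 * m + 1)) (v : r), ⁅v, b k.castSucc⁆ ∈ N := fun k v => by
    rw [hb]
    exact lie_mem_right ℝ r N _ _ (X k).2
  induction j using Fin.lastCases with
  | cast j => exact h j _
  | last =>
    induction i using Fin.lastCases with
    | cast i =>
      rw [← lie_skew]
      exact neg_mem (h i _)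
    | last => simp

include hb in
theorem repr_lie_last (i j : Fin (2 * m + 2)) :
    b.repr ⁅b i, b j⁆ (Fin.last (2 * m + 1)) = 0 :=
  repr_last_of_mem hb (lie_mem_of_basis hb i j)

include hX hb in
theorem lie_basis_eq_zero {i j : Fin (2 * m + 2)} (h : j < i.rev) : ⁅b i, b j⁆ = 0 := by
  have h' : i.val + j.val < 2 * m + 1 := by
    rw [Fin.lt_def, Fin.val_rev] at h
    omega
  have := hX.lie_eq_zero (i := ⟨i, by omega⟩) (j := ⟨j, by omega⟩) h'
  have e1 : b i = X ⟨i, by omega⟩ := hb ⟨i, by omega⟩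
  have e2 : b j = X ⟨j, by omega⟩ := hb ⟨j, by omega⟩
  rw [e1, e2]
  exact congrArg (Subtype.val) this

include hX hb in
theorem lie_basis_antidiagonal (i : Fin (2 * m)) :
    ⁅b (mid i), b (mid i).rev⁆ = (if i.val < m then (1 : ℝ) else -1) • b 0 := by
  have e0 : b 0 = X 0 := hb 0
  rw [rev_mid, hb, hb, e0]
  exact congrArg (Subtype.val) (hX.lie_antidiagonal i)

include hX hb in
theorem commutatorMatrix_eq_zero (x : Fin (2 * m + 2) → ℝ) {i j : Fin (2 * m + 2)}
    (h : j < i.rev) : commutatorMatrix b x i j = 0 := by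
  simp [commutatorMatrix, structConst, lie_basis_eq_zero hX hb h]

include hX hb in
theorem commutatorMatrix_antidiagonal (x : Fin (2 * m + 2) → ℝ) (i : Fin (2 * m)) :
    commutatorMatrix b x (mid i) (mid i).rev = (if i.val < m then (1 : ℝ) else -1) * x 0 := by
  rw [commutatorMatrix, Matrix.of_apply]
  simp only [structConst, lie_basis_antidiagonal hX hb]
  split_ifs <;> simp [Finsupp.single_apply]

theorem prod_sign_halves (m : ℕ) :
    ∏ i : Fin (2 * m), (if i.val < m then (1 : ℝ) else -1) = (-1) ^ m := by
  rw [Fin.prod_univ_eq_prod_range (fun i => if i < m then (1 : ℝ) else -1), two_mul,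
    Finset.prod_range_add, Finset.prod_congr rfl (g := fun _ => (1 : ℝ))]
  · simp
  · intro i hi
    rw [if_pos (Finset.mem_range.1 hi)]

include hX hb in
theorem det_commutatorMatrix (x : Fin (2 * m + 2) → ℝ) :
    (commutatorMatrix b x).det =
      x 0 ^ (2 * m) * (∑ k, structConst b 0 (Fin.last (2 * m + 1)) k * x k) ^ 2 := by
  rw [det_of_antitriangular _ fun i j => commutatorMatrix_eq_zero hX hb x,
    sign_revPerm, Fin.prod_univ_castSucc, Fin.prod_univ_succ]
  simp only [commutatorMatrix_antidiagonal hX hb, Finset.prod_mul_distrib, prod_sign_halves,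
    Fin.castSucc_zero, Fin.rev_zero, Fin.rev_last, Finset.prod_const, Finset.card_univ,
    Fintype.card_fin]
  rw [commutatorMatrix_skew b x (Fin.last _) 0]
  -- The sign of the reversal, the `m` entries `-x₁` and the skew pair of corner entries
  -- contribute `(-1) ^ (m + 1)`, `(-1) ^ m` and `-1`.
  have hs : (-1 : ℝ) ^ ((2 * m + 2) * (2 * m + 1) / 2) = (-1) ^ (m + 1) := by
    have : (2 * m + 2) * (2 * m + 1) / 2 = (m + 1) + 2 * ((m + 1) * m) := by
      apply Nat.div_eq_of_eq_mul_right two_pos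
      ring
    rw [this, pow_add, pow_mul]
    simp
  have hm : (-1 : ℝ) ^ m * (-1) ^ m = 1 := by rw [← mul_pow]; simp
  have hc : commutatorMatrix b x 0 (Fin.last (2 * m + 1)) =
      ∑ k, structConst b 0 (Fin.last (2 * m + 1)) k * x k := rfl
  push_cast
  rw [hs, hc, pow_succ]
  linear_combination (x 0 ^ (2 * m) *
    (∑ k, structConst b 0 (Fin.last (2 * m + 1)) k * x k) ^ 2) * hm

end Structure

/-! ### The Hamiltonian of the last basis vector -/

section SliceHamiltonian

open MvPolynomial

variable {r : Type*} [LieRing r] [LieAlgebra ℝ r] {m : ℕ} {α : ℕ → ℝ} {N : LieIdeal ℝ r}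
  {X : Module.Basis (Fin (2 * m + 1)) ℝ N} {b : Module.Basis (Fin (2 * m + 2)) ℝ r}

/-- An element of the Lie algebra, regarded as a function on the slice `x₁ = 1`, `x_{2m+2} = 0` of
the dual space, with `x₂, …, x_{2m+1}` as coordinates. -/
def slicePoly (b : Module.Basis (Fin (2 * m + 2)) ℝ r) : r →ₗ[ℝ] MvPolynomial (Fin (2 * m)) ℝ where
  toFun v := C (b.repr v 0) + ∑ k, C (b.repr v (mid k)) * MvPolynomial.X k
  map_add' v w := by
    simp only [map_add, Finsupp.add_apply, add_mul, Finset.sum_add_distrib]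
    ring
  map_smul' c v := by
    simp only [map_smul, Finsupp.smul_apply, smul_eq_mul, map_mul, RingHom.id_apply, smul_add,
      Finset.smul_sum, smul_eq_C_mul, mul_assoc]

theorem slicePoly_apply (v : r) :
    slicePoly b v = C (b.repr v 0) + ∑ k, C (b.repr v (mid k)) * MvPolynomial.X k := rfl

theorem pderiv_slicePoly (v : r) (l : Fin (2 * m)) :
    pderiv l (slicePoly b v) = C (b.repr v (mid l)) := by
  simp [slicePoly_apply, pderiv_X, Pi.single_apply]

/-- Linear functions are recovered from the slice by homogeneity. -/
theorem mul_eval_slicePoly {v : r} (hv : b.repr v (Fin.last (2 * m + 1)) = 0)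
    {x : Fin (2 * m + 2) → ℝ} (hx : x 0 ≠ 0) :
    x 0 * eval (fun i => x (mid i) / x 0) (slicePoly b v) = ∑ k, b.repr v k * x k := by
  rw [sum_eq_zero_add_mid_add_last, hv, zero_mul, add_zero, slicePoly_apply]
  simp only [map_add, map_sum, map_mul, eval_C, eval_X, mul_add, Finset.mul_sum]
  congr 1
  · ring
  · refine Finset.sum_congr rfl fun i _ => ?_
    field_simp

/-- On the slice the bracket with `w` acts on linear functions as a vector field; no derivative
in the direction of `x₁` occurs when `w` commutes with `X₁`. -/
theorem slicePoly_lie {w v : r} (hw : ⁅w, b 0⁆ = 0) (hv : b.repr v (Fin.last (2 * m + 1)) = 0) :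
    slicePoly b ⁅w, v⁆ = ∑ l, slicePoly b ⁅w, b (mid l)⁆ * pderiv l (slicePoly b v) := by
  conv_lhs => rw [← b.sum_repr v, sum_eq_zero_add_mid_add_last, hv]
  simp only [lie_add, lie_sum, lie_smul, hw, smul_zero, zero_add, zero_smul, add_zero,
    map_sum, map_smul, pderiv_slicePoly, smul_eq_C_mul]
  exact Finset.sum_congr rfl fun l _ => mul_comm _ _

/-- If the last basis vector commutes with `X₁`, its adjoint action is a derivation of the Poisson
bracket on the slice, hence Hamiltonian. The Poisson tensor has zeros above and signs on the
antidiagonal, so it is invertible over the polynomials. -/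
theorem exists_slice_hamiltonian (hX : IsNAlphaBasis m α X)
    (hb : ∀ i : Fin (2 * m + 1), b i.castSucc = (X i : r))
    (h0 : ⁅b (Fin.last (2 * m + 1)), b 0⁆ = 0) :
    ∃ h : MvPolynomial (Fin (2 * m)) ℝ, ∀ i, ∑ j, slicePoly b ⁅b (mid i), b (mid j)⁆ * pderiv j h =
      slicePoly b ⁅b (mid i), b (Fin.last (2 * m + 1))⁆ := by
  have hmid0 : ∀ i : Fin (2 * m), ⁅b (mid i), b 0⁆ = 0 := fun i =>
    lie_basis_eq_zero hX hb (by rw [rev_mid, Fin.lt_def]; simp)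
  have hl := repr_lie_last hb
  have hskew : ∀ v w : r, slicePoly b ⁅v, w⁆ = - slicePoly b ⁅w, v⁆ := fun v w => by
    rw [← lie_skew, map_neg]
  refine exists_hamiltonian (fun i j => slicePoly b ⁅b (mid i), b (mid j)⁆) _
    (fun i j => hskew _ _) (fun i j a => ?_) (fun i j => ?_) ?_
  · rw [← slicePoly_lie (hmid0 a) (hl _ _), ← slicePoly_lie (hmid0 j) (hl _ _),
      ← slicePoly_lie (hmid0 i) (hl _ _), ← map_add, ← map_add, add_assoc,
      show ∀ u v w : r, u + (v + w) = u + w + v by intros; abel,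
      add_right_comm, ← map_zero (slicePoly b)]
    congr 1
    have := lie_jacobi (b (mid a)) (b (mid i)) (b (mid j))
    rw [← this]
    abel
  · have e1 : ∑ l, slicePoly b ⁅b (mid l), b (Fin.last (2 * m + 1))⁆ *
        pderiv l (slicePoly b ⁅b (mid i), b (mid j)⁆) =
        - slicePoly b ⁅b (Fin.last (2 * m + 1)), ⁅b (mid i), b (mid j)⁆⁆ := by
      rw [slicePoly_lie h0 (hl _ _), ← Finset.sum_neg_distrib]
      refine Finset.sum_congr rfl fun l _ => ?_
      rw [hskew, neg_mul]
    have e2 : ∑ l, pderiv l (slicePoly b ⁅b (mid i), b (Fin.last (2 * m + 1))⁆) *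
        slicePoly b ⁅b (mid l), b (mid j)⁆ =
        - slicePoly b ⁅b (mid j), ⁅b (mid i), b (Fin.last (2 * m + 1))⁆⁆ := by
      rw [slicePoly_lie (hmid0 j) (hl _ _), ← Finset.sum_neg_distrib]
      refine Finset.sum_congr rfl fun l _ => ?_
      rw [hskew (b (mid l)), mul_neg, mul_comm (pderiv l _)]
    rw [e1, e2, ← slicePoly_lie (hmid0 i) (hl _ _), ← map_neg, ← map_neg, ← map_add]
    congr 1
    have := lie_jacobi (b (Fin.last (2 * m + 1))) (b (mid i)) (b (mid j))
    rw [← lie_skew (b (Fin.last (2 * m + 1))) (b (mid i)), lie_neg] at this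
    rw [neg_eq_iff_add_eq_zero, ← this]
    abel
  · refine isUnit_det_of_antitriangular _ (fun i j hij => ?_) fun i => ?_
    · rw [lie_basis_eq_zero hX hb, map_zero]
      rw [rev_mid]
      exact Fin.castSucc_lt_castSucc_iff.2 (Fin.succ_lt_succ_iff.2 hij)
    · rw [← rev_mid, lie_basis_antidiagonal hX hb, map_smul]
      have : slicePoly b (b 0) = 1 := by
        simp [slicePoly_apply]
      rw [this]
      split_ifs <;> simp

end SliceHamiltonian

/-! ### The second invariant -/

section Casimir

open MvPolynomial

variable {m : ℕ}

/-- Directional derivatives of polynomial functions, through the formal partial derivatives. -/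
theorem hasDerivAt_eval_line {κ : Type*} [Fintype κ] (h : MvPolynomial κ ℝ) (y w : κ → ℝ) :
    HasDerivAt (fun t : ℝ => eval (y + t • w) h) (∑ j, eval y (pderiv j h) * w j) 0 := by
  classical
  induction h using MvPolynomial.induction_on with
  | C a => simpa using hasDerivAt_const (0 : ℝ) a
  | add p q hp hq =>
    simp only [map_add, add_mul, Finset.sum_add_distrib]
    exact hp.add hq
  | mul_X p i hp =>
    have hX : HasDerivAt (fun t : ℝ => y i + t * w i) (w i) 0 := by
      simpa using ((hasDerivAt_id (0 : ℝ)).mul_const (w i)).const_add (y i)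
    have := hp.mul hX
    simp only [map_mul, eval_X, Pi.add_apply, Pi.smul_apply, smul_eq_mul]
    convert! this using 1
    simp only [pderiv_mul, pderiv_X, map_add, map_mul, eval_X, add_mul, Finset.sum_add_distrib,
      Finset.sum_mul, zero_smul, add_zero, zero_mul]
    congr 1
    · exact Finset.sum_congr rfl fun j _ => by ring
    · simp [Pi.single_apply, apply_ite (eval y)]

/-- The polynomial `x₁ ^ d * (x_{2m+2} - x₁ h(x₂ / x₁, …, x_{2m+1} / x₁))`, where `d` is the total
degree of `h`, with denominators cleared. -/
def casimir (h : MvPolynomial (Fin (2 * m)) ℝ) (x : Fin (2 * m + 2) → ℝ) : ℝ :=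
  x 0 ^ h.totalDegree * x (Fin.last (2 * m + 1)) - ∑ s ∈ h.support,
    coeff s h * (x 0 ^ (h.totalDegree + 1 - s.degree) * ∏ i, x (mid i) ^ s i)

theorem contDiff_casimir (h : MvPolynomial (Fin (2 * m)) ℝ) : ContDiff ℝ ∞ (casimir h) := by
  unfold casimir
  fun_prop

theorem casimir_eq (h : MvPolynomial (Fin (2 * m)) ℝ) {x : Fin (2 * m + 2) → ℝ} (hx : x 0 ≠ 0) :
    casimir h x = x 0 ^ h.totalDegree *
      (x (Fin.last (2 * m + 1)) - x 0 * eval (fun i => x (mid i) / x 0) h) := by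
  rw [casimir, mul_sub, eval_eq']
  simp only [Finset.mul_sum]
  congr 1
  refine Finset.sum_congr rfl fun s hs => ?_
  have hle : s.degree ≤ h.totalDegree := le_totalDegree hs
  have hp : ∏ i, (x (mid i) / x 0) ^ s i = (∏ i, x (mid i) ^ s i) / x 0 ^ s.degree := by
    simp_rw [div_pow]
    rw [Finset.prod_div_distrib, Finset.prod_pow_eq_pow_sum, Finsupp.degree_eq_sum]
  have hpow : x 0 ^ (h.totalDegree + 1 - s.degree) * x 0 ^ s.degree =
      x 0 ^ h.totalDegree * x 0 := by
    rw [← pow_add, ← pow_succ]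
    congr 1
    omega
  rw [hp]
  field_simp
  rw [show ∀ a b c d : ℝ, a * b * c * d = a * c * (b * d) by intros; ring, hpow]
  ring

theorem fderiv_casimir (h : MvPolynomial (Fin (2 * m)) ℝ) {x v : Fin (2 * m + 2) → ℝ}
    (hx : x 0 ≠ 0) (hv : v 0 = 0) :
    fderiv ℝ (casimir h) x v = x 0 ^ h.totalDegree * (v (Fin.last (2 * m + 1)) -
      ∑ j, eval (fun i => x (mid i) / x 0) (pderiv j h) * v (mid j)) := by
  have hline : HasDerivAt (fun t : ℝ => x + t • v) v 0 := by
    simpa using ((hasDerivAt_id (0 : ℝ)).smul_const v).const_add x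
  have h1 : HasDerivAt (fun t : ℝ => casimir h (x + t • v)) (fderiv ℝ (casimir h) x v) 0 := by
    refine HasFDerivAt.comp_hasDerivAt_of_eq 0
      ((contDiff_casimir h).differentiable (by simp) x).hasFDerivAt hline ?_
    simp
  have h2 := hasDerivAt_eval_line h (fun i => x (mid i) / x 0) (fun i => v (mid i) / x 0)
  have h3 : HasDerivAt (fun t : ℝ => x (Fin.last _) + t * v (Fin.last (2 * m + 1)))
      (v (Fin.last _)) 0 := by
    simpa using ((hasDerivAt_id (0 : ℝ)).mul_const (v (Fin.last _))).const_add (x (Fin.last _))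
  have h4 := (h3.sub (h2.const_mul (x 0))).const_mul (x 0 ^ h.totalDegree)
  have heq : (fun t : ℝ => casimir h (x + t • v)) = fun t => x 0 ^ h.totalDegree *
      (x (Fin.last _) + t * v (Fin.last (2 * m + 1)) -
        x 0 * eval ((fun i => x (mid i) / x 0) + t • fun i => v (mid i) / x 0) h) := by
    funext t
    have h0 : (x + t • v) 0 = x 0 := by simp [hv]
    rw [casimir_eq h (by rwa [h0]), h0]
    congr 5
    funext i
    simp [add_div, mul_div_assoc]
  rw [heq] at h1
  rw [h1.unique h4]
  congr 2
  rw [Finset.mul_sum]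
  refine Finset.sum_congr rfl fun j _ => ?_
  field_simp

end Casimir

/-! ### Codimension of the orbits and invariance -/

section Orbits

open MvPolynomial

variable {r : Type*} [LieRing r] [LieAlgebra ℝ r] {m : ℕ} {α : ℕ → ℝ} {N : LieIdeal ℝ r}
  {X : Module.Basis (Fin (2 * m + 1)) ℝ N} {b : Module.Basis (Fin (2 * m + 2)) ℝ r}

theorem dense_ne_zero {ι : Type*} [Fintype ι] {f : (ι → ℝ) →ₗ[ℝ] ℝ} (hf : f ≠ 0) :
    Dense {x | f x ≠ 0} :=
  (dense_compl_singleton (0 : ℝ)).preimage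
    (f.isOpenMap_of_finiteDimensional (LinearMap.surjective hf))

theorem isOpen_ne_zero {ι : Type*} [Fintype ι] (f : (ι → ℝ) →ₗ[ℝ] ℝ) :
    IsOpen {x | f x ≠ 0} :=
  isOpen_ne_fun f.continuous_of_finiteDimensional continuous_const

theorem continuous_commutatorMatrix {ι L : Type*} [Fintype ι] [LieRing L] [LieAlgebra ℝ L]
    (b : Module.Basis ι ℝ L) (i : ι) : Continuous fun x => commutatorMatrix b x i := by
  refine continuous_pi fun j => ?_
  simp only [commutatorMatrix, Matrix.of_apply]
  fun_prop

theorem map_commutatorMatrix {ι L : Type*} [Fintype ι] [DecidableEq ι] [LieRing L]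
    [LieAlgebra ℝ L] (b : Module.Basis ι ℝ L) (φ : (ι → ℝ) →L[ℝ] ℝ) (x : ι → ℝ) (i : ι) :
    φ (commutatorMatrix b x i) =
      ∑ k, commutatorMatrix b x i k * φ fun j => if k = j then 1 else 0 :=
  LinearMap.pi_apply_eq_sum_univ (φ : (ι → ℝ) →ₗ[ℝ] ℝ) _

/-- Where the commutator matrix is nonsingular, the orbits are open. -/
theorem eq_zero_of_det_ne_zero {ι L : Type*} [Fintype ι] [DecidableEq ι] [LieRing L]
    [LieAlgebra ℝ L] {b : Module.Basis ι ℝ L} {φ : (ι → ℝ) →L[ℝ] ℝ} {x : ι → ℝ}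
    (hx : (commutatorMatrix b x).det ≠ 0) (h : ∀ i, φ (commutatorMatrix b x i) = 0) : φ = 0 := by
  have h0 : (fun k => φ fun j => if k = j then 1 else 0) = 0 := by
    refine Matrix.eq_zero_of_mulVec_eq_zero hx (funext fun i => ?_)
    have := h i
    rw [map_commutatorMatrix] at this
    exact this
  ext v
  change (φ : (ι → ℝ) →ₗ[ℝ] ℝ) v = 0
  rw [LinearMap.pi_apply_eq_sum_univ]
  refine Finset.sum_eq_zero fun k _ => ?_
  have := congrFun h0 k
  simp only [Pi.zero_apply] at this
  rw [ContinuousLinearMap.coe_coe, this, smul_zero]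

variable (hX : IsNAlphaBasis m α X) (hb : ∀ i : Fin (2 * m + 1), b i.castSucc = (X i : r))

include hX hb in
/-- Where `x₁ ≠ 0`, the orbits have codimension at most two, and they are transverse to the plane
spanned by the first and the last coordinate direction. -/
theorem eq_zero_of_apply_zero_ne_zero {φ : (Fin (2 * m + 2) → ℝ) →L[ℝ] ℝ}
    {x : Fin (2 * m + 2) → ℝ} (hx : x 0 ≠ 0) (h : ∀ i, φ (commutatorMatrix b x i) = 0)
    (h0 : φ (fun j => if 0 = j then 1 else 0) = 0)
    (hl : φ (fun j => if Fin.last (2 * m + 1) = j then 1 else 0) = 0) : φ = 0 := by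
  let M : Matrix (Fin (2 * m)) (Fin (2 * m)) ℝ :=
    (commutatorMatrix b x).submatrix mid mid
  have hM : IsUnit M.det := by
    refine isUnit_det_of_antitriangular _ (fun i j hij => ?_) fun i => ?_
    · apply commutatorMatrix_eq_zero hX hb
      rw [rev_mid]
      exact Fin.castSucc_lt_castSucc_iff.2 (Fin.succ_lt_succ_iff.2 hij)
    · simp only [M, Matrix.submatrix_apply]
      rw [← rev_mid, commutatorMatrix_antidiagonal hX hb, isUnit_iff_ne_zero]
      refine mul_ne_zero ?_ hx
      split_ifs <;> simp
  have hmid : (fun k : Fin (2 * m) => φ fun j => if mid k = j then 1 else 0) = 0 := by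
    refine Matrix.eq_zero_of_mulVec_eq_zero hM.ne_zero (funext fun i => ?_)
    have := h (mid i)
    rw [map_commutatorMatrix, sum_eq_zero_add_mid_add_last, h0, hl, mul_zero, mul_zero, zero_add,
      add_zero] at this
    exact this
  ext v
  change (φ : (Fin (2 * m + 2) → ℝ) →ₗ[ℝ] ℝ) v = 0
  rw [LinearMap.pi_apply_eq_sum_univ, sum_eq_zero_add_mid_add_last]
  simp only [ContinuousLinearMap.coe_coe, h0, hl, smul_zero, zero_add, add_zero]
  refine Finset.sum_eq_zero fun k _ => ?_
  have := congrFun hmid k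
  simp only [Pi.zero_apply] at this
  rw [this, smul_zero]

theorem commutatorMatrix_eq_mul_eval (hb : ∀ i : Fin (2 * m + 1), b i.castSucc = (X i : r))
    {x : Fin (2 * m + 2) → ℝ} (hx : x 0 ≠ 0) (i j : Fin (2 * m + 2)) :
    commutatorMatrix b x i j =
      x 0 * eval (fun i => x (mid i) / x 0) (slicePoly b ⁅b i, b j⁆) := by
  rw [mul_eval_slicePoly (repr_lie_last hb i j) hx]
  rfl

include hX hb in
/-- `x₁` is invariant when `X₁` is central. -/
theorem commutatorMatrix_apply_zero (h0 : ⁅b (Fin.last (2 * m + 1)), b 0⁆ = 0)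
    (x : Fin (2 * m + 2) → ℝ) (i : Fin (2 * m + 2)) : commutatorMatrix b x i 0 = 0 := by
  induction i using Fin.lastCases with
  | cast i =>
    apply commutatorMatrix_eq_zero hX hb
    rw [Fin.lt_def, Fin.val_rev]
    simp only [Fin.val_zero, Fin.val_castSucc]
    omega
  | last => simp [commutatorMatrix, structConst, h0]

include hX hb in
/-- A Hamiltonian on the slice makes `casimir` invariant: where `x₁ ≠ 0` its equations rescale to
the orbit equations by homogeneity, and `x₁ = 0` is reached by continuity. -/
theorem fderiv_casimir_commutatorMatrix (h0 : ⁅b (Fin.last (2 * m + 1)), b 0⁆ = 0)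
    {h : MvPolynomial (Fin (2 * m)) ℝ}
    (hh : ∀ i, ∑ j, slicePoly b ⁅b (mid i), b (mid j)⁆ * pderiv j h =
      slicePoly b ⁅b (mid i), b (Fin.last (2 * m + 1))⁆)
    (x : Fin (2 * m + 2) → ℝ) (i : Fin (2 * m + 2)) :
    fderiv ℝ (casimir h) x (commutatorMatrix b x i) = 0 := by
  have hc : Continuous fun x => fderiv ℝ (casimir h) x (commutatorMatrix b x i) :=
    ((contDiff_casimir h).continuous_fderiv (by simp)).clm_apply (continuous_commutatorMatrix b i)
  have hd : Dense {x : Fin (2 * m + 2) → ℝ | x 0 ≠ 0} :=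
    dense_ne_zero (f := LinearMap.proj 0) fun h => by
      simpa using LinearMap.congr_fun h 1
  refine congrFun (hc.ext_on hd continuous_const fun x hx => ?_) x
  have hx : x 0 ≠ 0 := hx
  set y : Fin (2 * m) → ℝ := fun i => x (mid i) / x 0 with hy
  have hh' : ∀ i, ∑ j, commutatorMatrix b x (mid i) (mid j) * eval y (pderiv j h) =
      commutatorMatrix b x (mid i) (Fin.last (2 * m + 1)) := by
    intro i
    rw [commutatorMatrix_eq_mul_eval hb hx, ← hh i, map_sum, Finset.mul_sum]
    refine Finset.sum_congr rfl fun j _ => ?_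
    rw [commutatorMatrix_eq_mul_eval hb hx, map_mul, mul_assoc]
  beta_reduce
  rw [fderiv_casimir h hx (commutatorMatrix_apply_zero hX hb h0 x i)]
  refine mul_eq_zero_of_right _ (sub_eq_zero.2 ?_)
  induction i using Fin.lastCases with
  | last =>
    -- The last row follows from the others: it produces `pᵀ M p` with `M` skew.
    set p : Fin (2 * m) → ℝ := fun j => eval y (pderiv j h) with hp
    have hs : ∀ v : ℝ, v = -v → v = 0 := fun v hv => by linarith
    rw [hs _ (commutatorMatrix_skew b x (Fin.last _) (Fin.last _))]
    symm
    have hq : ∑ j, p j * commutatorMatrix b x (Fin.last _) (mid j) =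
        -∑ j, ∑ k, p j * commutatorMatrix b x (mid j) (mid k) * p k := by
      rw [← Finset.sum_neg_distrib]
      refine Finset.sum_congr rfl fun j _ => ?_
      rw [commutatorMatrix_skew, ← hh' j, mul_neg, Finset.mul_sum]
      simp only [hp, mul_assoc]
    rw [hq, neg_eq_zero]
    apply hs
    conv_lhs => rw [Finset.sum_comm]
    simp only [← Finset.sum_neg_distrib]
    refine Finset.sum_congr rfl fun j _ => Finset.sum_congr rfl fun k _ => ?_
    rw [commutatorMatrix_skew b x (mid k) (mid j)]
    ring
  | cast i =>
    rcases Fin.eq_zero_or_eq_succ i with rfl | ⟨i, rfl⟩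
    · have hz : ∀ j, commutatorMatrix b x (Fin.castSucc 0) j = 0 := by
        intro j
        rw [Fin.castSucc_zero, commutatorMatrix_skew, commutatorMatrix_apply_zero hX hb h0,
          neg_zero]
      simp only [hz, mul_zero, Finset.sum_const_zero]
    · rw [← hh' i]
      exact Finset.sum_congr rfl fun j _ => mul_comm _ _

end Orbits

theorem theorem3 {r : Type*} [LieRing r] [LieAlgebra ℝ r] [LieAlgebra.IsSolvable r]
    (m : ℕ) (hm : 1 ≤ m) (α : ℕ → ℝ)
    (N : LieIdeal ℝ r) (hN : IsNilradical N)
    (X : Module.Basis (Fin (2 * m + 1)) ℝ N) (hX : IsNAlphaBasis m α X)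
    (b : Module.Basis (Fin (2 * m + 2)) ℝ r)
    (hb : ∀ i : Fin (2 * m + 1), b i.castSucc = (X i : r)) :
    (∀ x : Fin (2 * m + 2) → ℝ,
      (commutatorMatrix b x).det =
        x 0 ^ (2 * m) * (∑ k, structConst b 0 (Fin.last (2 * m + 1)) k * x k) ^ 2) ∧
    (⁅b (Fin.last (2 * m + 1)), b 0⁆ ≠ 0 →
      (∀ U : Set (Fin (2 * m + 2) → ℝ), IsOpen U → U.Nonempty → HasInvariantNumber b U 0) ∧
      (∀ U : Set (Fin (2 * m + 2) → ℝ), IsOpen U → IsPreconnected U →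
        ∀ F : (Fin (2 * m + 2) → ℝ) → ℝ, IsInvariantOn b U F → ∃ c : ℝ, ∀ x ∈ U, F x = c)) ∧
    (⁅b (Fin.last (2 * m + 1)), b 0⁆ = 0 →
      ∃ F₂ : (Fin (2 * m + 2) → ℝ) → ℝ,
        ∀ U : Set (Fin (2 * m + 2) → ℝ), IsOpen U → U.Nonempty →
          IsFundamentalSet b U {fun x => x 0, F₂} ∧ HasInvariantNumber b U 2) := by
  let f₀ : (Fin (2 * m + 2) → ℝ) →ₗ[ℝ] ℝ := LinearMap.proj 0
  have hf₀ : f₀ ≠ 0 := fun h => by simpa [f₀] using LinearMap.congr_fun h 1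
  refine ⟨det_commutatorMatrix hX hb, fun hne => ?_, fun h0 => ?_⟩
  · let f₁ : (Fin (2 * m + 2) → ℝ) →ₗ[ℝ] ℝ :=
      ∑ k, structConst b 0 (Fin.last (2 * m + 1)) k • LinearMap.proj k
    have hf₁ : f₁ ≠ 0 := by
      intro h
      apply hne
      rw [← lie_skew, neg_eq_zero, ← b.repr.map_eq_zero_iff]
      ext k
      have := LinearMap.congr_fun h (Pi.single k 1)
      simpa [f₁, Pi.single_apply, structConst] using this
    have hdense : Dense {x | (commutatorMatrix b x).det ≠ 0} := by
      refine ((dense_ne_zero hf₀).inter_of_isOpen_right (dense_ne_zero hf₁)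
        (isOpen_ne_zero f₁)).mono fun x hx => ?_
      rw [Set.mem_ofPred_eq, det_commutatorMatrix hX hb]
      refine mul_ne_zero (pow_ne_zero _ hx.1) (pow_ne_zero _ ?_)
      simpa [f₁] using hx.2
    have hopen : IsOpen {x | (commutatorMatrix b x).det ≠ 0} := by
      refine isOpen_ne_fun (Continuous.matrix_det ?_) continuous_const
      exact continuous_pi fun i => continuous_commutatorMatrix b i
    constructor
    · intro U hU hUne
      have hempty : ∀ T : Set ((Fin (2 * m + 2) → ℝ) → ℝ), (∀ F ∈ T, IsInvariantOn b U F) →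
          FunctionallyIndependentOn U T → T = ∅ := by
        intro T hT hind
        have := encard_le_of_annihilator (n := 0) hU hT hind (hU.inter hopen)
          Set.inter_subset_left (hdense.inter_open_nonempty U hU hUne)
          fun x hx => ⟨Fin.elim0, fun φ hφ _ => eq_zero_of_det_ne_zero hx.2 hφ⟩
        simpa using this
      have hfund : IsFundamentalSet b U ∅ := by
        refine ⟨⟨by simp, fun x hx => subset_closure ⟨hx, linearIndependent_empty_type⟩⟩,
          fun T hT _ => (hempty T hT.1 hT.2).le⟩
      refine ⟨⟨∅, hfund⟩, fun S hS => ?_⟩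
      rw [hempty S hS.prop.1 hS.prop.2]
      simp
    · intro U hU hconn F hF
      have hzero : ∀ x ∈ U, fderiv ℝ F x = 0 := by
        have hsub : U ⊆ closure (U ∩ {x | (commutatorMatrix b x).det ≠ 0}) :=
          hdense.open_subset_closure_inter hU
        have hcont := hF.1.continuousOn_fderiv_of_isOpen hU (by simp)
        have : Set.EqOn (fderiv ℝ F) (fun _ => 0) (U ∩ {x | (commutatorMatrix b x).det ≠ 0}) := by
          intro x hx
          refine eq_zero_of_det_ne_zero hx.2 fun i => ?_
          simpa [coadjointVec_basis] using hF.fderiv_coadjointVec hU hx.1 (b i)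
        exact this.of_subset_closure hcont continuousOn_const Set.inter_subset_left hsub
      exact hU.exists_is_const_of_fderiv_eq_zero hconn
        (fun x hx => (hF.differentiableAt hU hx).differentiableWithinAt) hzero
  · obtain ⟨h, hh⟩ := exists_slice_hamiltonian hX hb h0
    refine ⟨casimir h, fun U hU hUne => ?_⟩
    have hproj : ∀ x : Fin (2 * m + 2) → ℝ, fderiv ℝ (fun x : Fin (2 * m + 2) → ℝ => x 0) x =
        ContinuousLinearMap.proj 0 := fun x =>
      (ContinuousLinearMap.proj (R := ℝ) (φ := fun _ : Fin (2 * m + 2) => ℝ) 0).fderiv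
    have hdense := dense_ne_zero hf₀
    refine isFundamentalSet_pair hU hUne
      (isInvariantOn_of_fderiv (contDiff_apply ℝ ℝ 0) (fun x i => ?_) U)
      (isInvariantOn_of_fderiv (contDiff_casimir h)
        (fderiv_casimir_commutatorMatrix hX hb h0 hh) U) ?_ fun T hT hind => ?_
    · rw [hproj]
      exact commutatorMatrix_apply_zero hX hb h0 x i
    -- Where `x₁ ≠ 0`, the derivative of the second invariant in the last direction is a power
    -- of `x₁`, while that of `x₁` vanishes.
    · refine (hdense.open_subset_closure_inter hU).trans
        (closure_mono fun x hx => ⟨hx.1, fun c d hcd => ?_⟩)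
      have hx0 : x 0 ≠ 0 := hx.2
      rw [hproj] at hcd
      have hd : d = 0 := by
        have := congrArg (fun φ => φ (Pi.single (Fin.last (2 * m + 1)) 1)) hcd
        simpa [fderiv_casimir h hx0, hx0] using this
      subst hd
      have := congrArg (fun φ => φ (Pi.single 0 1)) hcd
      simpa using this
    · exact encard_le_of_annihilator (n := 2) hU hT hind (hU.inter (isOpen_ne_zero f₀))
        Set.inter_subset_left (hdense.inter_open_nonempty U hU hUne) fun x hx =>
        ⟨![fun j => if 0 = j then 1 else 0, fun j => if Fin.last (2 * m + 1) = j then 1 else 0],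
          fun φ hφ hw => eq_zero_of_apply_zero_ne_zero hX hb hx.2 hφ (hw 0) (hw 1)⟩

end
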